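/- Let $s,d\ge 0$ be integers. For a group $G$ put $G_1=G$ and $G_{j+1}=[G,G_j]$; $G$ is $s$-step nilpotent if $G_{s+1}=\{e_G\}$. An $s$-step $\mathbb{Z}^d$-nilsystem is a space $X$ with $d$ pairwise commuting homeomorphisms $T_1,\dots,T_d$ of $X$ such that $X$ is (identified by a homeomorphism with) a quotient $G/\Gamma$, where $G$ is an $s$-step nilpotent (real, finite-dimensional, second countable) Lie group and $\Gamma$ is a discrete subgroup of $G$ with $G/\Gamma$ compact, and such that each $T_i$ is a left translation $g\Gamma\mapsto\tau_i g\Gamma$ by some $\tau_i\in G$. It is minimal if for every $x\in X$ the orbit $\{T_1^{n_1}\cdots T_d^{n_d}x:n\in\mathbb{Z}^d\}$ is dense in $X$, and connected if $X$ is connected. Let $(X=G/\Gamma,T_1,\dots,T_d)$ be a minimal $s$-step $\mathbb{Z}^d$-nilsystem, let $e_X=e_G\Gamma$, and let $X_0$ be the connected component of $e_X$ in $X$. Then there is a $d\times d$ matrix $K=(K_{i,j})$ with nonnegative integer entries, invertible as a real matrix, such that each map $S_i=T_1^{K_{i,1}}\circ\cdots\circ T_d^{K_{i,d}}$ ($1\le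 i\le d$) restricts to a homeomorphism of $X_0$ and $(X_0,S_1,\dots,S_d)$ is a connected minimal $s$-step $\mathbb{Z}^d$-nilsystem. -/

import Mathlib

open scoped Manifold ContDiff

universe u v

/-- `Γ` is a discrete cocompact subgroup of the `s`-step nilpotent (real, finite-dimensional,
Hausdorff, second countable) Lie group `G`, that is, `G ⧸ Γ` is an `s`-step nilmanifold.
In Mathlib the lower central series starts at index `0` with the whole group, so its term of
index `s` is `G_{s+1}` for the numbering `G_1 = G`, `G_{j+1} = [G, G_j]`. -/
structure IsNilmanifold (s : ℕ) {G : Type*} [Group G] [TopologicalSpace G]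
    (Γ : Subgroup G) : Prop where
  lieGroup : ∃ (n : ℕ) (_ : ChartedSpace (EuclideanSpace ℝ (Fin n)) G), LieGroup (𝓡 n) ∞ G
  t2Space : T2Space G
  secondCountable : SecondCountableTopology G
  nilpotent : (⊤ : Subgroup G).lowerCentralSeries s = ⊥
  discrete : DiscreteTopology Γ
  cocompact : CompactSpace (G ⧸ Γ)

/-- The homeomorphism `T_1 ^ n_1 ∘ ⋯ ∘ T_d ^ n_d`. -/
def zdAction {d : ℕ} {X : Type*} [TopologicalSpace X] (T : Fin d → (X ≃ₜ X))
    (n : Fin d → ℤ) : X ≃ₜ X :=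
  (List.ofFn fun j => T j ^ n j).prod

/-- The system `(X, T_1, …, T_d)` is minimal: every point has a dense orbit. -/
def IsMinimalSystem {d : ℕ} {X : Type*} [TopologicalSpace X] (T : Fin d → (X ≃ₜ X)) : Prop :=
  ∀ x : X, Dense (Set.range fun n : Fin d → ℤ => zdAction T n x)

/-- The homeomorphism `φ` presents `(X, T_1, …, T_d)` as the `s`-step `ℤ^d`-nilsystem on the
nilmanifold `G ⧸ Γ` in which `T_i` is the left translation by `τ i`. -/
structure IsNilPresentation (s : ℕ) {d : ℕ} {X : Type*} [TopologicalSpace X]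
    (T : Fin d → (X ≃ₜ X)) {G : Type*} [Group G] [TopologicalSpace G] (Γ : Subgroup G)
    (τ : Fin d → G) (φ : (G ⧸ Γ) ≃ₜ X) : Prop where
  nilmanifold : IsNilmanifold s Γ
  commute : ∀ i j, Commute (T i) (T j)
  translation : ∀ (i : Fin d) (x : G ⧸ Γ), T i (φ x) = φ (τ i • x)

/-- `(X, T_1, …, T_d)` is an `s`-step `ℤ^d`-nilsystem. -/
def IsNilsystem (s : ℕ) {d : ℕ} {X : Type v} [TopologicalSpace X]
    (T : Fin d → (X ≃ₜ X)) : Prop :=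
  ∃ (G : Type u) (_ : Group G) (_ : TopologicalSpace G) (Γ : Subgroup G) (τ : Fin d → G)
    (φ : (G ⧸ Γ) ≃ₜ X), IsNilPresentation s T Γ τ φ

open Topology Set

/-! Let `L` be the set of `g` in `G` whose translation preserves the component `X₀` of the base
point. It is a subgroup containing `Γ`, and it is open because `G ⧸ Γ` is locally connected.
Compactness of `G ⧸ Γ` then gives it finite index. Hence a single `N > 0` satisfies `g ^ N ∈ L` for
all `g`, and `K` is `N` times the identity, so that `S i` is `T i ^ N`. Since `Γ ≤ L`, the space
`X₀` is the nilmanifold `L ⧸ Γ`, with `S i` the translation by `τ i ^ N`.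

Minimality is purely topological (`isClopen_closure_orbit_of_finite_cosets`): in a minimal action of
a commutative group on a compact space, orbit closures of a finite-index subgroup form a finite
partition into closed sets, so they are clopen. Such a closure, taken at a point of `X₀`, contains
all of `X₀`. -/

/-- The image of a connected component under a homeomorphism is a connected component. -/
theorem Homeomorph.image_connectedComponent {X Y : Type*} [TopologicalSpace X]
    [TopologicalSpace Y] (h : X ≃ₜ Y) (x : X) :
    h '' connectedComponent x = connectedComponent (h x) := by
  simpa [connectedComponentIn_univ] using h.image_connectedComponentIn (mem_univ x)

theorem Homeomorph.apply_mem_connectedComponent_iff {X Y : Type*} [TopologicalSpace X]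
    [TopologicalSpace Y] (h : X ≃ₜ Y) {x y : X} :
    h y ∈ connectedComponent (h x) ↔ y ∈ connectedComponent x := by
  rw [← h.image_connectedComponent, h.injective.mem_set_image]

/-! ### Orbit closures of finite-index subgroups in minimal actions -/

section Dynamics

variable {A X : Type*} [CommGroup A] [TopologicalSpace X]

/-- A nonempty compact space on which a set of maps acts has a minimal nonempty closed
invariant subset. -/
theorem exists_minimal_nonempty_closed_invariant [CompactSpace X] [Nonempty X]
    (F : Set (X → X)) :
    ∃ M : Set X, Minimal (fun V : Set X => V.Nonempty ∧ IsClosed V ∧ ∀ f ∈ F, MapsTo f V V) M := by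
  have hchain : ∀ c ⊆ {V : Set X | V.Nonempty ∧ IsClosed V ∧ ∀ f ∈ F, MapsTo f V V},
      IsChain (· ⊆ ·) c → c.Nonempty →
      ∃ lb ∈ {V : Set X | V.Nonempty ∧ IsClosed V ∧ ∀ f ∈ F, MapsTo f V V}, ∀ V ∈ c, lb ⊆ V := by
    intro c hc hchain hne
    refine ⟨⋂₀ c, ⟨?_, isClosed_sInter fun V hV => (hc hV).2.1, ?_⟩,
      fun V hV => sInter_subset_of_mem hV⟩
    · have := hne.to_subtype
      have hdir : Directed (· ⊇ ·) (fun V : c => (V : Set X)) := fun U V =>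
        (hchain.total U.2 V.2).elim (fun h => ⟨U, subset_rfl, h⟩) (fun h => ⟨V, h, subset_rfl⟩)
      rw [sInter_eq_iInter]
      exact IsCompact.nonempty_iInter_of_directed_nonempty_isCompact_isClosed _
        hdir (fun V => (hc V.2).1)
        (fun V => (hc V.2).2.1.isCompact) (fun V => (hc V.2).2.1)
    · exact fun f hf x hx V hV => (hc hV).2.2 f hf (hx V hV)
  obtain ⟨M, -, hM⟩ := zorn_superset_nonempty _ hchain univ
    ⟨univ_nonempty, isClosed_univ, fun f _ => mapsTo_univ f univ⟩
  exact ⟨M, hM⟩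

/-- Under a minimal action of a commutative group on a compact space, the orbit closures of a
subgroup with finitely many cosets are clopen. -/
theorem isClopen_closure_orbit_of_finite_cosets [CompactSpace X] (f : A →* (X ≃ₜ X))
    (hmin : ∀ x, Dense (range fun a => f a x)) (H : Subgroup A) {R : Set A} (hR : R.Finite)
    (hRH : ∀ a, ∃ r ∈ R, ∃ h ∈ H, a = r * h) (x : X) :
    IsClopen (closure ((fun a => f a x) '' (H : Set A))) := by
  set C : X → Set X := fun y => closure ((fun a => f a y) '' (H : Set A)) with hC
  have hself : ∀ y, y ∈ C y := fun y => subset_closure ⟨1, H.one_mem, by simp⟩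
  have hinv : ∀ y, ∀ h ∈ H, MapsTo (f h) (C y) (C y) := by
    intro y h hh
    refine MapsTo.closure ?_ (f h).continuous
    rintro _ ⟨a, ha, rfl⟩
    exact ⟨h * a, H.mul_mem hh ha, by simp⟩
  -- Commutativity of `A` is what makes `f a` carry `H`-orbits to `H`-orbits.
  have htrans : ∀ a y, C (f a y) = f a '' C y := by
    intro a y
    rw [hC]
    simp only [(f a).image_closure, image_image, ← Homeomorph.mul_apply, ← map_mul, mul_comm a]
  have : Nonempty X := ⟨x⟩
  obtain ⟨M, hM⟩ := exists_minimal_nonempty_closed_invariant (X := X)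
    ((fun a => ⇑(f a)) '' (H : Set A))
  obtain ⟨⟨⟨y, hyM⟩, hMcl, hMinv⟩, hMmin⟩ := hM
  have hCM : ∀ z ∈ M, C z = M := by
    intro z hz
    have hsub : C z ⊆ M := by
      refine closure_minimal ?_ hMcl
      rintro _ ⟨a, ha, rfl⟩
      exact hMinv _ ⟨a, ha, rfl⟩ hz
    refine hsub.antisymm (hMmin ⟨⟨z, hself z⟩, isClosed_closure, ?_⟩ hsub)
    rintro _ ⟨a, ha, rfl⟩
    exact hinv z a ha
  -- Finitely many translates of `M` have a closed union, and it contains the dense `A`-orbit of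
  -- `y`.
  have hcover : ∀ z, ∃ r ∈ R, z ∈ f r '' M := by
    have hcl : IsClosed (⋃ r ∈ R, f r '' M) :=
      hR.isClosed_biUnion fun r _ => (f r).isClosedMap _ hMcl
    have hdense : (⋃ r ∈ R, f r '' M) = univ := by
      refine ((hmin y).mono ?_).closure_eq ▸ hcl.closure_eq.symm
      rintro _ ⟨a, rfl⟩
      obtain ⟨r, hr, h, hh, rfl⟩ := hRH a
      refine mem_biUnion hr ⟨f h y, hMinv _ ⟨h, hh, rfl⟩ hyM, by simp⟩
    intro z
    simpa using hdense.ge (mem_univ z)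
  have hCr : ∀ r, ∀ z ∈ f r '' M, C z = f r '' M := by
    rintro r _ ⟨z, hz, rfl⟩
    rw [htrans, hCM z hz]
  refine ⟨isClosed_closure, ?_⟩
  -- Each translate of `M` is the orbit closure of all its points, so distinct translates are
  -- disjoint, and `C x` is one of them.
  have hcompl : (C x)ᶜ = ⋃ r ∈ {r ∈ R | f r '' M ≠ C x}, f r '' M := by
    ext z
    simp only [mem_compl_iff, mem_iUnion, exists_prop]
    constructor
    · intro hz
      obtain ⟨r, hr, hzr⟩ := hcover z
      exact ⟨r, ⟨hr, fun he => hz (he ▸ hzr)⟩, hzr⟩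
    · rintro ⟨r, ⟨-, hne⟩, hzr⟩ hzx
      obtain ⟨r', -, hxr'⟩ := hcover x
      rw [hCr r' x hxr'] at hzx hne
      exact hne ((hCr r z hzr).symm.trans (hCr r' z hzx))
  change IsOpen (C x)
  rw [← isClosed_compl_iff, hcompl]
  exact (hR.subset (sep_subset _ _)).isClosed_biUnion fun r _ => (f r).isClosedMap _ hMcl

end Dynamics

/-! ### Actions of `ℤ^d` generated by commuting homeomorphisms -/

section ZdAction

variable {X : Type*} [TopologicalSpace X]

theorem List.prod_ofFn_mul_of_commute {G : Type*} [Monoid G] {d : ℕ} (a b : Fin d → G)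
    (h : ∀ i j, Commute (a i) (b j)) :
    (List.ofFn fun i => a i * b i).prod = (List.ofFn a).prod * (List.ofFn b).prod := by
  induction d with
  | zero => simp
  | succ d ih =>
    simp only [List.ofFn_succ, List.prod_cons]
    rw [ih _ _ fun i j => h i.succ j.succ]
    have : Commute (b 0) (List.ofFn fun i => a (Fin.succ i)).prod := by
      refine Commute.list_prod_right _ _ fun y hy => ?_
      obtain ⟨i, rfl⟩ := (List.mem_ofFn' _ _).1 hy
      exact (h _ _).symm
    simp only [mul_assoc, this.left_comm]

/-- The `ℤ^d`-action generated by commuting homeomorphisms, as a group homomorphism. -/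
def zdActionHom {d : ℕ} (T : Fin d → (X ≃ₜ X)) (hT : ∀ i j, Commute (T i) (T j)) :
    Multiplicative (Fin d → ℤ) →* (X ≃ₜ X) where
  toFun n := zdAction T n.toAdd
  map_one' := by simp [zdAction]
  map_mul' m n := by
    simp only [zdAction, toAdd_mul, Pi.add_apply, zpow_add]
    exact List.prod_ofFn_mul_of_commute _ _ fun i j => ((hT i j).zpow_zpow _ _)

theorem zdAction_zsmul {d : ℕ} (T : Fin d → (X ≃ₜ X)) (N : ℤ) (n : Fin d → ℤ) :
    zdAction T (N • n) = zdAction (fun i => T i ^ N) n := by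
  simp [zdAction, zpow_mul]

theorem zdAction_single {d : ℕ} (T : Fin d → (X ≃ₜ X)) (i : Fin d) (k : ℤ) :
    zdAction T (Pi.single i k) = T i ^ k := by
  induction d with
  | zero => exact i.elim0
  | succ d ih =>
    simp only [zdAction, List.ofFn_succ, List.prod_cons] at ih ⊢
    induction i using Fin.cases with
    | zero => simp
    | succ i =>
      have := ih (fun j => T j.succ) i
      rw [Pi.single_eq_of_ne (Fin.succ_ne_zero i).symm, zpow_zero, one_mul, ← this]
      congr 2
      ext1 j
      by_cases hj : j = i
      · subst hj; simp
      · rw [Pi.single_eq_of_ne hj, Pi.single_eq_of_ne (by simpa using hj)]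

/-- If each `S i` is the restriction of `T i` to a subset, then so is the generated action. -/
theorem coe_zdAction_of_coe {d : ℕ} {Y : Set X} (T : Fin d → (X ≃ₜ X)) (S : Fin d → (Y ≃ₜ Y))
    (hS : ∀ i y, (S i y : X) = T i y) (n : Fin d → ℤ) (y : Y) :
    (zdAction S n y : X) = zdAction T n y := by
  have hinv : ∀ i y, (((S i)⁻¹ y : Y) : X) = (T i)⁻¹ y := by
    intro i y
    apply (T i).injective
    rw [← hS, ← Homeomorph.mul_apply, ← Homeomorph.mul_apply]
    simp
  have hpow : ∀ i (k : ℤ) y, ((S i ^ k) y : X) = (T i ^ k) y := by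
    intro i k
    induction k with
    | zero => simp
    | succ k ih => intro y; rw [zpow_add_one, zpow_add_one, Homeomorph.mul_apply, ih, hS]; rfl
    | pred k ih => intro y; rw [zpow_sub_one, zpow_sub_one, Homeomorph.mul_apply, ih, hinv]; rfl
  unfold zdAction
  induction d with
  | zero => simp
  | succ d ih =>
    simp only [List.ofFn_succ, List.prod_cons, Homeomorph.mul_apply, hpow]
    rw [ih (fun i => T i.succ) (fun i => S i.succ) (fun i => hS i.succ) (fun i => n i.succ)
      (fun i => hinv i.succ) (fun i => hpow i.succ)]

/-- For commuting homeomorphisms generating a minimal action on a compact space, the orbit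
closures of the system of `N`-th powers are clopen. -/
theorem isClopen_closure_zdAction_pow [CompactSpace X] {d : ℕ} (T : Fin d → (X ≃ₜ X))
    (hT : ∀ i j, Commute (T i) (T j)) (hmin : IsMinimalSystem T) {N : ℕ} (hN : 0 < N) (x : X) :
    IsClopen (closure (range fun n : Fin d → ℤ => zdAction (fun i => T i ^ N) n x)) := by
  have key := isClopen_closure_orbit_of_finite_cosets (zdActionHom T hT) (fun x => hmin x)
    (powMonoidHom N : Multiplicative (Fin d → ℤ) →* _).range
    -- The box `[0, N]^d` repeats some residues mod `N`; only covering all cosets matters.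
    (R := Multiplicative.toAdd ⁻¹' Icc (0 : Fin d → ℤ) (fun _ => (N : ℤ)))
    ((finite_Icc _ _).preimage Multiplicative.toAdd.injective.injOn) ?_ x
  · convert key using 2
    ext y
    simp only [mem_range, mem_image, SetLike.mem_coe, MonoidHom.mem_range, powMonoidHom_apply,
      exists_exists_eq_and]
    refine Multiplicative.ofAdd.exists_congr fun n => ?_
    have := zdAction_zsmul T N n
    simp only [zpow_natCast] at this
    rw [← this]
    change _ ↔ zdAction T (N • n) x = y
    rw [natCast_zsmul]
  · intro a
    have hN' : (N : ℤ) ≠ 0 := by exact_mod_cast hN.ne'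
    refine ⟨.ofAdd fun i => a.toAdd i % N, ⟨fun i => Int.emod_nonneg _ hN', fun i =>
      (Int.emod_lt_of_pos _ (by exact_mod_cast hN)).le⟩, _, ⟨.ofAdd fun i => a.toAdd i / N, rfl⟩, ?_⟩
    apply Multiplicative.toAdd.injective
    funext i
    simp [Int.emod_add_mul_ediv]

end ZdAction

/-! ### Open subgroups of Lie groups -/

section Lie

/-- An open subgroup of a Lie group is a Lie group for the charts of the open submanifold. -/
theorem Subgroup.exists_lieGroup_of_isOpen {n : ℕ} {G : Type*} [Group G] [TopologicalSpace G]
    [ChartedSpace (EuclideanSpace ℝ (Fin n)) G] [LieGroup (𝓡 n) ∞ G] (L : Subgroup G)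
    (hL : IsOpen (L : Set G)) :
    ∃ _ : ChartedSpace (EuclideanSpace ℝ (Fin n)) L, LieGroup (𝓡 n) ∞ L := by
  let U : TopologicalSpace.Opens G := ⟨L, hL⟩
  let c : ChartedSpace (EuclideanSpace ℝ (Fin n)) L :=
    inferInstanceAs (ChartedSpace (EuclideanSpace ℝ (Fin n)) U)
  have hval : ContMDiff (𝓡 n) (𝓡 n) ∞ (Subtype.val : L → G) :=
    contMDiff_subtype_val (U := U)
  refine ⟨c, { (inferInstanceAs (IsManifold (𝓡 n) ∞ U) : IsManifold (𝓡 n) ∞ L) with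
    contMDiff_mul := ?_, contMDiff_inv := ?_ }⟩
  · refine (ContMDiff.subtypeVal_comp_iff U (fun p : L × L => p.1 * p.2)).1 ?_
    exact (hval.comp contMDiff_fst).mul (hval.comp contMDiff_snd)
  · refine (ContMDiff.subtypeVal_comp_iff U (fun a : L => (a⁻¹ : L))).1 ?_
    exact hval.inv (I := 𝓡 n)

end Lie

/-! ### The stabilizer of the identity component of a nilmanifold -/

section Component

/-- The map `L ⧸ (Γ ⊓ L) → G ⧸ Γ` induced by the inclusion of a subgroup `L`. -/
def Subgroup.quotientInclusion {G : Type*} [Group G] (Γ L : Subgroup G) :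
    L ⧸ Γ.subgroupOf L → G ⧸ Γ :=
  Quotient.map' Subtype.val fun a b => by
    simp_rw [QuotientGroup.leftRel_eq]
    exact id

theorem Subgroup.quotientInclusion_smul {G : Type*} [Group G] {Γ L : Subgroup G} (a : L)
    (x : L ⧸ Γ.subgroupOf L) :
    Γ.quotientInclusion L (a • x) = (a : G) • Γ.quotientInclusion L x := by
  induction x using QuotientGroup.induction_on with
  | H g => rfl

variable {G : Type*} [Group G] [TopologicalSpace G] [IsTopologicalGroup G]

/-- The stabilizer of the connected component of the base point of `G ⧸ Γ`. -/
def Subgroup.componentStabilizer (Γ : Subgroup G) : Subgroup G where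
  -- Translations permute the components, so where the base point goes decides whether this one is
  -- preserved.
  carrier := {g | (g : G ⧸ Γ) ∈ connectedComponent ((1 : G) : G ⧸ Γ)}
  one_mem' := mem_connectedComponent
  mul_mem' {a b} ha hb := by
    have := (Homeomorph.smul a : (G ⧸ Γ) ≃ₜ (G ⧸ Γ)).apply_mem_connectedComponent_iff.2 hb
    simp only [Homeomorph.smul_apply, MulAction.Quotient.smul_coe, smul_eq_mul, mul_one] at this
    rwa [← connectedComponent_eq ha] at this
  inv_mem' {a} ha := by
    apply (Homeomorph.smul a : (G ⧸ Γ) ≃ₜ (G ⧸ Γ)).apply_mem_connectedComponent_iff.1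
    simp only [Homeomorph.smul_apply, MulAction.Quotient.smul_coe, smul_eq_mul, mul_one,
      mul_inv_cancel]
    rw [← connectedComponent_eq ha]
    exact mem_connectedComponent

theorem Subgroup.mem_componentStabilizer {Γ : Subgroup G} {g : G} :
    g ∈ Γ.componentStabilizer ↔ (g : G ⧸ Γ) ∈ connectedComponent ((1 : G) : G ⧸ Γ) :=
  Iff.rfl

theorem Subgroup.le_componentStabilizer (Γ : Subgroup G) : Γ ≤ Γ.componentStabilizer := by
  intro g hg
  rw [mem_componentStabilizer, (QuotientGroup.eq (s := Γ) (a := g) (b := 1)).2 (by simpa using hg)]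
  exact mem_connectedComponent

theorem Subgroup.isOpen_componentStabilizer [LocallyConnectedSpace G] (Γ : Subgroup G) :
    IsOpen (Γ.componentStabilizer : Set G) := by
  have : LocallyConnectedSpace (G ⧸ Γ) :=
    QuotientGroup.isOpenQuotientMap_mk.isQuotientMap.locallyConnectedSpace
  exact isOpen_connectedComponent.preimage QuotientGroup.continuous_mk

/-- The quotient `G ⧸ L` is discrete, and compact as an image of `G ⧸ Γ`. -/
theorem Subgroup.finiteIndex_of_isOpen_of_le {Γ L : Subgroup G} [CompactSpace (G ⧸ Γ)]
    (hL : IsOpen (L : Set G)) (hΓ : Γ ≤ L) : L.FiniteIndex := by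
  have := QuotientGroup.discreteTopology hL
  have hc : Continuous (Subgroup.quotientMapOfLE hΓ) :=
    QuotientGroup.isOpenQuotientMap_mk.isQuotientMap.continuous_iff.2 QuotientGroup.continuous_mk
  have hs : Function.Surjective (Subgroup.quotientMapOfLE hΓ) := by
    intro q
    induction q using QuotientGroup.induction_on with
    | H g => exact ⟨(g : G ⧸ Γ), rfl⟩
  have : CompactSpace (G ⧸ L) := hs.compactSpace hc
  have : Finite (G ⧸ L) := finite_of_compact_of_discrete
  exact Subgroup.finiteIndex_of_finite_quotient

/-- The inclusion of an open subgroup induces an open embedding of quotients. -/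
theorem Subgroup.isOpenEmbedding_quotientInclusion (Γ : Subgroup G) {L : Subgroup G}
    (hL : IsOpen (L : Set G)) : IsOpenEmbedding (Γ.quotientInclusion L) := by
  have hq : IsOpenQuotientMap (QuotientGroup.mk : L → L ⧸ Γ.subgroupOf L) :=
    QuotientGroup.isOpenQuotientMap_mk
  refine .of_continuous_injective_isOpenMap ?_ ?_ ?_
  · exact hq.isQuotientMap.continuous_iff.2 (QuotientGroup.continuous_mk.comp continuous_subtype_val)
  · intro x y
    induction x using QuotientGroup.induction_on with
    | H a =>
    induction y using QuotientGroup.induction_on with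
    | H b =>
    intro h
    exact QuotientGroup.eq.2 (Subgroup.mem_subgroupOf.2 (QuotientGroup.eq.1 h))
  · intro U hU
    have : Γ.quotientInclusion L '' U =
        (QuotientGroup.mk : G → G ⧸ Γ) '' (Subtype.val '' ((QuotientGroup.mk : L → _) ⁻¹' U)) := by
      conv_lhs => rw [← image_preimage_eq U hq.surjective]
      simp only [image_image]
      rfl
    rw [this]
    exact QuotientGroup.isOpenMap_coe _ (hL.isOpenMap_subtype_val _ (hU.preimage hq.continuous))

theorem Subgroup.range_quotientInclusion_componentStabilizer (Γ : Subgroup G) :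
    range (Γ.quotientInclusion Γ.componentStabilizer) =
      connectedComponent ((1 : G) : G ⧸ Γ) := by
  ext x
  induction x using QuotientGroup.induction_on with
  | H g =>
  constructor
  · rintro ⟨y, hy⟩
    rw [← hy]
    induction y using QuotientGroup.induction_on with
    | H a => exact a.2
  · exact fun hg => ⟨((⟨g, hg⟩ : Γ.componentStabilizer) : _ ⧸ _), rfl⟩

theorem IsNilmanifold.componentStabilizer {s : ℕ} {Γ : Subgroup G} (h : IsNilmanifold s Γ)
    (hL : IsOpen (Γ.componentStabilizer : Set G)) :
    IsNilmanifold s (Γ.subgroupOf Γ.componentStabilizer) where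
  lieGroup := by
    obtain ⟨n, _, _⟩ := h.lieGroup
    exact ⟨n, Γ.componentStabilizer.exists_lieGroup_of_isOpen hL⟩
  t2Space := have := h.t2Space; inferInstance
  secondCountable := have := h.secondCountable; TopologicalSpace.Subtype.secondCountableTopology _
  nilpotent := by
    rw [← (Subgroup.map_injective (Subgroup.subtype_injective _)).eq_iff, Subgroup.map_bot,
      eq_bot_iff, ← h.nilpotent]
    refine (Subgroup.top_subtype_lowerCentralSeries Γ.componentStabilizer s).trans_le ?_
    exact Subgroup.lowerCentralSeries_mono s le_top
  discrete := by
    have := h.discrete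
    refine DiscreteTopology.of_continuous_injective
      (f := fun g : Γ.subgroupOf Γ.componentStabilizer => (⟨g, g.2⟩ : Γ)) ?_ ?_
    · fun_prop
    · intro a b hab
      exact Subtype.ext (Subtype.ext congr(($hab : G)))
  cocompact := by
    have := h.cocompact
    have he := Γ.isOpenEmbedding_quotientInclusion hL
    -- `L ⧸ Γ` embeds onto a connected component, which is closed in the compact space `G ⧸ Γ`.
    exact (IsClosedEmbedding.mk he.isEmbedding
      (Γ.range_quotientInclusion_componentStabilizer ▸ isClosed_connectedComponent)).compactSpace

end Component

/-! ### The system of `N`-th powers on the component -/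

theorem mainTheorem6 (s d : ℕ) {X : Type v} [TopologicalSpace X]
    (T : Fin d → (X ≃ₜ X)) {G : Type u} [Group G] [TopologicalSpace G] (Γ : Subgroup G)
    (τ : Fin d → G) (φ : (G ⧸ Γ) ≃ₜ X) (hX : IsNilPresentation s T Γ τ φ)
    (hmin : IsMinimalSystem T) :
    ∃ K : Matrix (Fin d) (Fin d) ℕ, IsUnit (K.map (Nat.cast : ℕ → ℝ)) ∧
      ∃ S : Fin d → (connectedComponent (φ ((1 : G) : G ⧸ Γ)) ≃ₜ
          connectedComponent (φ ((1 : G) : G ⧸ Γ))),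
        (∀ i x, (S i x : X) = zdAction T (fun j => (K i j : ℤ)) (x : X)) ∧
        ConnectedSpace (connectedComponent (φ ((1 : G) : G ⧸ Γ))) ∧
        IsMinimalSystem S ∧
        IsNilsystem.{u, v} s S := by
  have hnil := hX.nilmanifold
  obtain ⟨n, _, _⟩ := hnil.lieGroup
  have : IsTopologicalGroup G := topologicalGroup_of_lieGroup (𝓡 n) ∞
  have : LocallyConnectedSpace G := ChartedSpace.locallyConnectedSpace (EuclideanSpace ℝ (Fin n)) G
  have := hnil.cocompact
  have : CompactSpace X := φ.compactSpace
  set L := Γ.componentStabilizer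
  have hL : IsOpen (L : Set G) := Γ.isOpen_componentStabilizer
  have hfin : L.FiniteIndex := Subgroup.finiteIndex_of_isOpen_of_le hL Γ.le_componentStabilizer
  obtain ⟨N, hN, hNL⟩ : ∃ N : ℕ, 0 < N ∧ ∀ g : G, g ^ N ∈ L :=
    -- `L` need not be normal, so the index itself may fail as exponent; but some `g ^ m` with `0 <
    -- m ≤ L.index` lies in `L`, and `m` divides the factorial.
    ⟨L.index.factorial, Nat.factorial_pos _, fun g => Subgroup.pow_mem_of_index_ne_zero_of_dvd
      hfin.index_ne_zero g fun m hm hmL => Nat.dvd_factorial hm hmL⟩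
  have hTφ : ∀ i (k : ℕ) x, (T i ^ k) (φ x) = φ (τ i ^ k • x) := by
    intro i k x
    induction k with
    | zero => simp
    | succ k ih => rw [pow_succ', Homeomorph.mul_apply, ih, hX.translation, pow_succ', mul_smul]
  set x₀ : X := φ ((1 : G) : G ⧸ Γ) with hx₀
  have hstab : ∀ i x, x ∈ connectedComponent x₀ ↔ (T i ^ N) x ∈ connectedComponent x₀ := by
    intro i x
    rw [← (T i ^ N).apply_mem_connectedComponent_iff]
    have : (T i ^ N) x₀ ∈ connectedComponent x₀ := by
      rw [hx₀, hTφ, φ.apply_mem_connectedComponent_iff]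
      rw [MulAction.Quotient.smul_coe, smul_eq_mul, mul_one]
      exact hNL (τ i)
    rw [connectedComponent_eq this]
  let S : Fin d → (connectedComponent x₀ ≃ₜ connectedComponent x₀) :=
    fun i => (T i ^ N).subtype (hstab i)
  have hS : ∀ i x, (S i x : X) = (T i ^ N) x := fun i x => rfl
  refine ⟨N • (1 : Matrix (Fin d) (Fin d) ℕ), ?_, S, ?_, ?_, ?_, ?_⟩
  · have : (N • (1 : Matrix (Fin d) (Fin d) ℕ)).map (Nat.cast : ℕ → ℝ) =
        algebraMap ℝ (Matrix (Fin d) (Fin d) ℝ) N := by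
      ext i j
      rw [Matrix.map_apply, Matrix.smul_apply, Matrix.one_apply]
      simp [Matrix.algebraMap_matrix_apply]
    rw [this]
    exact (IsUnit.mk0 (N : ℝ) (by exact_mod_cast hN.ne')).map _
  · intro i x
    have : (fun j => (((N • (1 : Matrix (Fin d) (Fin d) ℕ)) i j : ℕ) : ℤ)) =
        Pi.single i (N : ℤ) := by
      ext j
      simp [Matrix.one_apply, Pi.single_apply, eq_comm]
    rw [this, zdAction_single, zpow_natCast, hS]
  · exact Subtype.connectedSpace isConnected_connectedComponent
  · intro x
    have hcoe := coe_zdAction_of_coe (fun i => T i ^ N) S hS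
    have hcl := isClopen_closure_zdAction_pow T hX.commute hmin hN (x : X)
    rw [Subtype.dense_iff]
    have hxm : (x : X) ∈ closure (range fun n : Fin d → ℤ => zdAction (fun i => T i ^ N) n x) :=
      subset_closure ⟨0, by simp [zdAction]⟩
    -- A clopen set contains the component of each of its points, here `X₀`.
    have hsub := hcl.connectedComponent_subset hxm
    rw [← connectedComponent_eq x.2] at hsub
    refine hsub.trans (closure_mono ?_)
    rintro _ ⟨n, rfl⟩
    exact ⟨zdAction S n x, ⟨n, rfl⟩, hcoe n x⟩
  · let e : (L ⧸ Γ.subgroupOf L) ≃ₜ connectedComponent x₀ :=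
      (Γ.isOpenEmbedding_quotientInclusion hL).isEmbedding.toHomeomorph.trans <|
        φ.subtype fun x => by
          rw [Γ.range_quotientInclusion_componentStabilizer, hx₀,
            φ.apply_mem_connectedComponent_iff]
    have he : ∀ x, (e x : X) = φ (Γ.quotientInclusion L x) := fun x => rfl
    refine ⟨L, inferInstance, inferInstance, Γ.subgroupOf L, fun i => ⟨τ i ^ N, hNL _⟩, e,
      hnil.componentStabilizer hL, fun i j => ?_, fun i x => ?_⟩
    · ext x
      have := (hX.commute i j).pow_pow N N
      exact congr($this x)
    · ext1
      rw [hS, he, he, hTφ, Subgroup.quotientInclusion_smul]
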